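/- Let $C$ be a bounded convex subset of a real normed space $(X,\|\cdot\|)$, let $T:C\to C$ be non-expansive, i.e. $\|Tx-Ty\|\le\|x-y\|$ for all $x,y\in C$, let $\alpha_k\in[0,1]$ for $k\ge 1$ and $x_0\in C$, and let $$x_k=(1-\alpha_k)x_{k-1}+\alpha_k Tx_{k-1}\qquad(k\ge 1)$$ be the Krasnosel'ski\u{\i}--Mann iterates. Then, for every $n$ with $\sum_{i=1}^n\alpha_i(1-\alpha_i)>0$, $$\|x_n-Tx_n\|\le\frac{\operatorname{diam}(C)}{\sqrt{\pi\sum_{i=1}^n\alpha_i(1-\alpha_i)}}.$$ (This is the Baillon--Bruck conjecture, with the universal constant $\kappa=1/\sqrt\pi$.) Moreover, put $\pi_0^n=\prod_{j=1}^n(1-\alpha_j)$ and $\pi_k^n=\alpha_k\prod_{j=k+1}^n(1-\alpha_j)$ for $1\le k\le n$, and define $c_{mn}$ recursively by $c_{-1,n}=1$ for $n\ge 0$ and $$c_{mn}=\sum_{j=0}^m\sum_{k=m+1}^n\pi_j^m\,\pi_k^n\,c_{j-1,k-1}\qquad(0\le m\le n).$$ Then $\|x_m-x_n\|\le\operatorname{diam}(C)\,c_{mn}$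 for all $0\le m\le n$, and hence $\|x_n-Tx_n\|\le\operatorname{diam}(C)\,c_{n,n+1}/\alpha_{n+1}$ for every $n\ge 0$ with $\alpha_{n+1}>0$. The constant $1/\sqrt\pi$ is the best one obtainable from this recursive bound: it is the least real number $\kappa$ such that $$\sqrt{\sum_{i=1}^n\alpha_i(1-\alpha_i)}\;\frac{c_{n,n+1}}{\alpha_{n+1}}\le\kappa$$ for all $n\ge 0$ and all sequences $(\alpha_k)_{k\ge1}$ in $[0,1]$ with $\alpha_{n+1}>0$. -/

import Mathlib

/-- The Krasnosel'skii-Mann iterates of `T` with step sizes `α 1, α 2, …` started at `x₀`: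
`x 0 = x₀` and `x k = (1 - α k) x (k-1) + α k T (x (k-1))` for `k ≥ 1`.
The value `α 0` is not used. -/
def kmIterate {X : Type*} [AddCommGroup X] [Module ℝ X] (T : X → X) (α : ℕ → ℝ) (x₀ : X) : ℕ → X
  | 0 => x₀
  | k + 1 => (1 - α (k + 1)) • kmIterate T α x₀ k + α (k + 1) • T (kmIterate T α x₀ k)

/-- The weight `π_k^n = α_k ∏_{j=k+1}^n (1 - α_j)`, where `α_0` is read as `1`
whatever the value of the function `α` at `0`. -/
noncomputable def kmWeight (α : ℕ → ℝ) (k n : ℕ) : ℝ :=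
  (if k = 0 then 1 else α k) * ∏ j ∈ Finset.Icc (k + 1) n, (1 - α j)

/-- The recursive bounds with both indices shifted by one: `kmBoundShift α a b = c_{a-1,b-1}`.
So `kmBoundShift α 0 b` is the boundary value `c_{-1,b-1} = 1`. The value at `(m + 1, 0)`,
which would be `c_{m,-1}`, is a dummy and is never used. -/
noncomputable def kmBoundShift (α : ℕ → ℝ) : ℕ → ℕ → ℝ
  | 0, _ => 1
  | _ + 1, 0 => 0
  | m + 1, n + 1 => ∑ j : Fin (m + 1), ∑ k ∈ Finset.Icc (m + 1) n,
      kmWeight α j m * kmWeight α k n * kmBoundShift α j k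
termination_by a _ => a
decreasing_by exact j.isLt

/-- The recursive bounds `c_{mn}` for `m, n ≥ 0`. -/
noncomputable def kmBound (α : ℕ → ℝ) (m n : ℕ) : ℝ := kmBoundShift α (m + 1) (n + 1)

/-- The recursion `c_{mn} = ∑_{j=0}^m ∑_{k=m+1}^n π_j^m π_k^n c_{j-1,k-1}`,
with `c_{-1,k-1} = 1`. -/
theorem kmBound_rec (α : ℕ → ℝ) (m n : ℕ) :
    kmBound α m n = ∑ j ∈ Finset.range (m + 1), ∑ k ∈ Finset.Icc (m + 1) n,
      kmWeight α j m * kmWeight α k n * (if j = 0 then 1 else kmBound α (j - 1) (k - 1)) := by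
  rw [kmBound, kmBoundShift, Finset.sum_range]
  refine Finset.sum_congr rfl fun j _ => Finset.sum_congr rfl fun k hk => ?_
  have hk1 : 1 ≤ k := by
    have := (Finset.mem_Icc.mp hk).1
    omega
  congr 1
  split_ifs with h
  · rw [h, kmBoundShift]
  · rw [kmBound, Nat.sub_add_cancel (Nat.one_le_iff_ne_zero.mpr h), Nat.sub_add_cancel hk1]

open Real

/-! ### The expected sign of a difference of two Bernoulli sums -/

/-! The recursive bounds have a closed form: for m ≤ n, c_{mn} is the expected sign of a difference
of independent Bernoulli sums, since both satisfy the same one-step recursions and vanish on the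
diagonal (`kmBound_eq_and_kmMean_eq`). The iterates obey these recursions as inequalities
(`norm_kmIterate_sub_le`), and the residual bound becomes `signMean α n n 1`. On the diagonal the
difference D is a symmetric lazy walk with i-th step ±1, each with probability α_i(1 - α_i). By
symmetry E sign(1 + D) = P(D = 0) + P(D = 1), which Fourier inversion writes as an integral of 1 +
cos θ against the characteristic function of D (`signMean_self_one`). Bounding each factor by an
exponential leaves a Gaussian integral, the source of 1/√π. For α = 1/2 the integral is Wallis's,
and its asymptotics show that the constant is optimal. -/

/-- The expected value of `sign (e + ∑_{i=1}^n F i - ∑_{i=1}^m H i)`, where the `F i` and `H i` are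
independent Bernoulli variables of parameter `α i`, in recursive form. -/
noncomputable def signMean (α : ℕ → ℝ) : ℕ → ℕ → ℤ → ℝ
  | 0, 0, e => (e.sign : ℝ)
  | 0, n + 1, e => (1 - α (n + 1)) * signMean α 0 n e + α (n + 1) * signMean α 0 n (e + 1)
  | m + 1, n, e => (1 - α (m + 1)) * signMean α m n e + α (m + 1) * signMean α m n (e - 1)

theorem signMean_succ_left (α : ℕ → ℝ) (m n : ℕ) (e : ℤ) :
    signMean α (m + 1) n e =
      (1 - α (m + 1)) * signMean α m n e + α (m + 1) * signMean α m n (e - 1) := by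
  rw [signMean]

theorem signMean_succ_right (α : ℕ → ℝ) (m n : ℕ) (e : ℤ) :
    signMean α m (n + 1) e =
      (1 - α (n + 1)) * signMean α m n e + α (n + 1) * signMean α m n (e + 1) := by
  induction m generalizing e with
  | zero => rw [signMean]
  | succ m ih =>
    rw [signMean_succ_left, ih, ih, signMean_succ_left, signMean_succ_left, sub_add_cancel,
      add_sub_cancel_right]
    ring

/-- Two steps at once: a symmetric step of a lazy random walk. -/
theorem signMean_succ_succ (α : ℕ → ℝ) (m : ℕ) (e : ℤ) :
    signMean α (m + 1) (m + 1) e =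
      (1 - 2 * (α (m + 1) * (1 - α (m + 1)))) * signMean α m m e +
        α (m + 1) * (1 - α (m + 1)) * (signMean α m m (e + 1) + signMean α m m (e - 1)) := by
  rw [signMean_succ_left, signMean_succ_right, signMean_succ_right, sub_add_cancel]
  ring

theorem signMean_self_neg (α : ℕ → ℝ) (n : ℕ) (e : ℤ) :
    signMean α n n (-e) = -signMean α n n e := by
  induction n generalizing e with
  | zero => simp [signMean]
  | succ n ih =>
    rw [signMean_succ_succ, signMean_succ_succ, ih, show -e + 1 = -(e - 1) by ring,
      show -e - 1 = -(e + 1) by ring, ih, ih]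
    ring

theorem signMean_self_zero (α : ℕ → ℝ) (n : ℕ) : signMean α n n 0 = 0 := by
  have h := signMean_self_neg α n 0
  rw [neg_zero] at h
  linarith

theorem signMean_zero_one (α : ℕ → ℝ) (n : ℕ) : signMean α 0 n 1 = 1 := by
  have h : ∀ e : ℤ, 0 < e → signMean α 0 n e = 1 := by
    induction n with
    | zero => intro e he; simp [signMean, Int.sign_eq_one_of_pos he]
    | succ n ih =>
      intro e he
      rw [signMean_succ_right, ih e he, ih (e + 1) (by omega)]
      ring
  exact h 1 one_pos

/-! ### The recursive bounds as expected signs -/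

theorem kmWeight_succ_of_le (α : ℕ → ℝ) {k n : ℕ} (h : k ≤ n) :
    kmWeight α k (n + 1) = (1 - α (n + 1)) * kmWeight α k n := by
  rw [kmWeight, kmWeight, Finset.prod_Icc_succ_top (by omega)]
  ring

theorem kmWeight_succ_self (α : ℕ → ℝ) (n : ℕ) : kmWeight α (n + 1) (n + 1) = α (n + 1) := by
  simp [kmWeight]

/-- The average `∑_{j=0}^m π_j^m c_{j-1,n}` of the recursive bounds. -/
noncomputable def kmMean (α : ℕ → ℝ) (m n : ℕ) : ℝ :=
  ∑ j ∈ Finset.range (m + 1), kmWeight α j m * kmBoundShift α j (n + 1)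

theorem kmMean_zero (α : ℕ → ℝ) (n : ℕ) : kmMean α 0 n = 1 := by
  simp [kmMean, kmWeight, kmBoundShift]

theorem kmMean_succ (α : ℕ → ℝ) (m n : ℕ) :
    kmMean α (m + 1) n = (1 - α (m + 1)) * kmMean α m n + α (m + 1) * kmBound α m n := by
  rw [kmMean, Finset.sum_range_succ, kmWeight_succ_self, kmMean, kmBound, Finset.mul_sum]
  congr 1
  refine Finset.sum_congr rfl fun j hj => ?_
  rw [kmWeight_succ_of_le α (Nat.lt_succ_iff.mp (Finset.mem_range.mp hj)), mul_assoc]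

theorem kmBound_self (α : ℕ → ℝ) (n : ℕ) : kmBound α n n = 0 := by
  rw [kmBound_rec]
  exact Finset.sum_eq_zero fun j _ => by rw [Finset.Icc_eq_empty (by omega), Finset.sum_empty]

theorem kmBound_succ (α : ℕ → ℝ) {m n : ℕ} (h : m ≤ n) :
    kmBound α m (n + 1) = (1 - α (n + 1)) * kmBound α m n + α (n + 1) * kmMean α m n := by
  rw [kmBound, kmBoundShift, kmBound, kmBoundShift, kmMean, Finset.sum_range, Finset.mul_sum,
    Finset.mul_sum, ← Finset.sum_add_distrib]
  refine Finset.sum_congr rfl fun j _ => ?_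
  rw [Finset.sum_Icc_succ_top (by omega), kmWeight_succ_self, Finset.mul_sum]
  congr 1
  · refine Finset.sum_congr rfl fun k hk => ?_
    rw [kmWeight_succ_of_le α (Finset.mem_Icc.mp hk).2]
    ring
  · ring

/-- The two identities feed each other: at fixed m, `kmMean` determines `kmBound` by induction on n
from the zero diagonal; together they give `kmMean` at m + 1. -/
theorem kmBound_eq_and_kmMean_eq (α : ℕ → ℝ) (m : ℕ) :
    (∀ n, m ≤ n → kmBound α m n = signMean α m n 0) ∧
      ∀ n, m ≤ n → kmMean α m n = signMean α m n 1 := by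
  have step : ∀ m, (∀ n, m ≤ n → kmMean α m n = signMean α m n 1) →
      ∀ n, m ≤ n → kmBound α m n = signMean α m n 0 := by
    intro m hm n hn
    induction n, hn using Nat.le_induction with
    | base => rw [kmBound_self, signMean_self_zero]
    | succ n hn ih => rw [kmBound_succ α hn, signMean_succ_right, ih, hm n hn, zero_add]
  induction m with
  | zero =>
    have h : ∀ n, 0 ≤ n → kmMean α 0 n = signMean α 0 n 1 := fun n _ => by
      rw [kmMean_zero, signMean_zero_one]
    exact ⟨step 0 h, h⟩
  | succ m ih =>
    have h : ∀ n, m + 1 ≤ n → kmMean α (m + 1) n = signMean α (m + 1) n 1 := fun n hn => by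
      rw [kmMean_succ, signMean_succ_left, ih.1 n (by omega), ih.2 n (by omega), sub_self]
    exact ⟨step _ h, h⟩

theorem kmBound_eq_signMean (α : ℕ → ℝ) {m n : ℕ} (h : m ≤ n) :
    kmBound α m n = signMean α m n 0 :=
  (kmBound_eq_and_kmMean_eq α m).1 n h

theorem kmBound_succ_div (α : ℕ → ℝ) {n : ℕ} (h : 0 < α (n + 1)) :
    kmBound α n (n + 1) / α (n + 1) = signMean α n n 1 := by
  rw [kmBound_eq_signMean α n.le_succ, signMean_succ_right, signMean_self_zero, mul_zero, zero_add,
    zero_add, mul_div_cancel_left₀ _ h.ne']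

/-! ### The iterates -/

section Iterates

variable {X : Type*} [NormedAddCommGroup X] [NormedSpace ℝ X] {C : Set X} {T : X → X}
  {α : ℕ → ℝ} {x₀ : X}

theorem kmIterate_mem (hC : Convex ℝ C) (hT : Set.MapsTo T C C)
    (hα : ∀ k, 1 ≤ k → α k ∈ Set.Icc (0 : ℝ) 1) (hx₀ : x₀ ∈ C) (n : ℕ) :
    kmIterate T α x₀ n ∈ C := by
  induction n with
  | zero => exact hx₀
  | succ n ih =>
    have h := hα (n + 1) n.succ_pos
    exact hC ih (hT ih) (sub_nonneg.mpr h.2) h.1 (sub_add_cancel _ _)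

theorem norm_sub_convexComb_le {a b c d u v : ℝ} {x y z : X} (ha : a ∈ Set.Icc (0 : ℝ) 1)
    (hy : ‖y - x‖ ≤ d * u) (hz : ‖z - x‖ ≤ d * v) (hb : b = 1 - a) (hc : c = b * u + a * v) :
    ‖b • y + a • z - x‖ ≤ d * c := by
  have hb0 : 0 ≤ b := by rw [hb]; exact sub_nonneg.mpr ha.2
  have h : b • y + a • z - x = b • (y - x) + a • (z - x) := by
    rw [hb]; module
  calc ‖b • y + a • z - x‖ ≤ ‖b • (y - x)‖ + ‖a • (z - x)‖ := h ▸ norm_add_le _ _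
    _ = b * ‖y - x‖ + a * ‖z - x‖ := by
      rw [norm_smul_of_nonneg hb0, norm_smul_of_nonneg ha.1]
    _ ≤ b * (d * u) + a * (d * v) :=
      add_le_add (mul_le_mul_of_nonneg_left hy hb0) (mul_le_mul_of_nonneg_left hz ha.1)
    _ = d * c := by rw [hc]; ring

/-- The mixed differences x_m - T x_n close the induction. Expanding x_{m+1} in x_{m+1} - T x_n
produces T x_m - T x_n, which non-expansiveness returns to x_m - x_n. The diameter enters only at m
= 0. -/
theorem norm_kmIterate_sub_le (hC : Convex ℝ C) (hb : Bornology.IsBounded C)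
    (hT : Set.MapsTo T C C) (hne : ∀ x ∈ C, ∀ y ∈ C, ‖T x - T y‖ ≤ ‖x - y‖)
    (hα : ∀ k, 1 ≤ k → α k ∈ Set.Icc (0 : ℝ) 1) (hx₀ : x₀ ∈ C) (m : ℕ) :
    (∀ n, m ≤ n → ‖kmIterate T α x₀ m - kmIterate T α x₀ n‖ ≤
        Metric.diam C * signMean α m n 0) ∧
      ∀ n, m ≤ n → ‖kmIterate T α x₀ m - T (kmIterate T α x₀ n)‖ ≤
        Metric.diam C * signMean α m n 1 := by
  have hmem := kmIterate_mem hC hT hα hx₀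
  have step : ∀ m, (∀ n, m ≤ n → ‖kmIterate T α x₀ m - T (kmIterate T α x₀ n)‖ ≤
      Metric.diam C * signMean α m n 1) → ∀ n, m ≤ n →
        ‖kmIterate T α x₀ m - kmIterate T α x₀ n‖ ≤ Metric.diam C * signMean α m n 0 := by
    intro m hm n hn
    induction n, hn using Nat.le_induction with
    | base => rw [signMean_self_zero, sub_self, norm_zero, mul_zero]
    | succ n hn ih =>
      have h := hm n hn
      rw [norm_sub_rev] at h ih ⊢
      exact norm_sub_convexComb_le (hα (n + 1) n.succ_pos) ih h rfl
        (by rw [signMean_succ_right, zero_add])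
  induction m with
  | zero =>
    have h : ∀ n, 0 ≤ n → ‖kmIterate T α x₀ 0 - T (kmIterate T α x₀ n)‖ ≤
        Metric.diam C * signMean α 0 n 1 := fun n _ => by
      rw [signMean_zero_one, mul_one, ← dist_eq_norm]
      exact Metric.dist_le_diam_of_mem hb hx₀ (hT (hmem n))
    exact ⟨step 0 h, h⟩
  | succ m ih =>
    have h : ∀ n, m + 1 ≤ n → ‖kmIterate T α x₀ (m + 1) - T (kmIterate T α x₀ n)‖ ≤
        Metric.diam C * signMean α (m + 1) n 1 := fun n hn =>
      norm_sub_convexComb_le (hα (m + 1) m.succ_pos) (ih.2 n (by omega))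
        ((hne _ (hmem m) _ (hmem n)).trans (ih.1 n (by omega))) rfl
        (by rw [signMean_succ_left, sub_self])
    exact ⟨step _ h, h⟩

end Iterates

/-! ### The integral representation -/

theorem integral_cos_int_mul (k : ℤ) :
    ∫ θ in (-π)..π, cos (k * θ) = if k = 0 then 2 * π else 0 := by
  split_ifs with h
  · simp [h]; ring
  · have hk : (k : ℝ) ≠ 0 := by exact_mod_cast h
    rw [intervalIntegral.integral_comp_mul_left (fun x => cos x) hk, integral_cos]
    simp [Real.sin_int_mul_pi]

theorem integral_one_add_cos_mul_cos (e : ℤ) :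
    ∫ θ in (-π)..π, (1 + cos θ) * cos (e * θ) =
      π * (((e + 1).sign : ℝ) - ((e - 1).sign : ℝ)) := by
  have h : ∀ θ : ℝ, (1 + cos θ) * cos (e * θ) = cos (e * θ) +
      (1 / 2 * cos (((e + 1 : ℤ) : ℝ) * θ) + 1 / 2 * cos (((e - 1 : ℤ) : ℝ) * θ)) := by
    intro θ
    push_cast
    rw [add_mul (e : ℝ), sub_mul (e : ℝ), one_mul, cos_add, cos_sub]
    ring
  have hi : ∀ k : ℤ, IntervalIntegrable (fun θ : ℝ => cos (k * θ)) MeasureTheory.volume (-π) π :=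
    fun k => (by fun_prop : Continuous fun θ : ℝ => cos (k * θ)).intervalIntegrable _ _
  simp_rw [h]
  rw [intervalIntegral.integral_add (hi _) (((hi _).const_mul _).add ((hi _).const_mul _)),
    intervalIntegral.integral_add ((hi _).const_mul _) ((hi _).const_mul _),
    intervalIntegral.integral_const_mul, intervalIntegral.integral_const_mul,
    integral_cos_int_mul, integral_cos_int_mul, integral_cos_int_mul]
  obtain h | h | h | h | h : e = 0 ∨ e = 1 ∨ e = -1 ∨ 1 < e ∨ e < -1 := by omega
  · subst h; norm_num; ring
  · subst h; norm_num [show Int.sign 2 = 1 from rfl]; ring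
  · subst h; norm_num [show Int.sign 2 = 1 from rfl]; ring
  · rw [if_neg (by omega), if_neg (by omega), if_neg (by omega),
      Int.sign_eq_one_of_pos (by omega), Int.sign_eq_one_of_pos (by omega)]
    simp
  · rw [if_neg (by omega), if_neg (by omega), if_neg (by omega),
      Int.sign_eq_neg_one_of_neg (by omega), Int.sign_eq_neg_one_of_neg (by omega)]
    simp

/-- Differencing replaces the sign by a finitely supported function of e, with transform
proportional to 1 + cos θ. A walk step averages cos((e ± 1)θ), hence multiplies the integrand by one
more factor of the characteristic function. -/
theorem signMean_add_one_sub (α : ℕ → ℝ) (n : ℕ) (e : ℤ) :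
    π * (signMean α n n (e + 1) - signMean α n n (e - 1)) =
      ∫ θ in (-π)..π, (1 + cos θ) * cos (e * θ) *
        ∏ i ∈ Finset.Icc 1 n, (1 - 2 * (α i * (1 - α i)) * (1 - cos θ)) := by
  induction n generalizing e with
  | zero => simp [signMean, integral_one_add_cos_mul_cos]
  | succ n ih =>
    set q := α (n + 1) * (1 - α (n + 1)) with hq
    have h : ∀ θ : ℝ, (1 + cos θ) * cos (e * θ) *
        ∏ i ∈ Finset.Icc 1 (n + 1), (1 - 2 * (α i * (1 - α i)) * (1 - cos θ)) =
        (1 - 2 * q) * ((1 + cos θ) * cos (e * θ) *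
          ∏ i ∈ Finset.Icc 1 n, (1 - 2 * (α i * (1 - α i)) * (1 - cos θ))) +
        (q * ((1 + cos θ) * cos (((e + 1 : ℤ) : ℝ) * θ) *
          ∏ i ∈ Finset.Icc 1 n, (1 - 2 * (α i * (1 - α i)) * (1 - cos θ))) +
        q * ((1 + cos θ) * cos (((e - 1 : ℤ) : ℝ) * θ) *
          ∏ i ∈ Finset.Icc 1 n, (1 - 2 * (α i * (1 - α i)) * (1 - cos θ)))) := by
      intro θ
      rw [Finset.prod_Icc_succ_top (by omega), ← hq]
      push_cast
      rw [add_mul (e : ℝ), sub_mul (e : ℝ), one_mul, cos_add, cos_sub]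
      ring
    have hi : ∀ (k : ℤ) (c : ℝ), IntervalIntegrable (fun θ : ℝ => c * ((1 + cos θ) * cos (k * θ) *
        ∏ i ∈ Finset.Icc 1 n, (1 - 2 * (α i * (1 - α i)) * (1 - cos θ))))
        MeasureTheory.volume (-π) π := fun k c =>
      Continuous.intervalIntegrable (by fun_prop) _ _
    simp_rw [h]
    rw [intervalIntegral.integral_add (hi _ _) ((hi _ _).add (hi _ _)),
      intervalIntegral.integral_add (hi _ _) (hi _ _), intervalIntegral.integral_const_mul,
      intervalIntegral.integral_const_mul, intervalIntegral.integral_const_mul, ← ih, ← ih, ← ih,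
      signMean_succ_succ, signMean_succ_succ, ← hq]
    ring_nf

theorem signMean_self_one (α : ℕ → ℝ) (n : ℕ) :
    2 * π * signMean α n n 1 = ∫ θ in (-π)..π, (1 + cos θ) *
      ∏ i ∈ Finset.Icc 1 n, (1 - 2 * (α i * (1 - α i)) * (1 - cos θ)) := by
  have h := signMean_add_one_sub α n 0
  rw [zero_add, zero_sub, signMean_self_neg] at h
  simp only [Int.cast_zero, zero_mul, cos_zero, mul_one] at h
  rw [← h]
  ring

/-! ### The Gaussian estimate -/

/-- Since 1 - cos θ = 2 sin²(θ/2) and 1 + cos θ = 2 cos²(θ/2) ≤ 2 cos(θ/2), the substitution u =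
sin(θ/2) gives a Gaussian on [-1, 1], then extended to the whole line. -/
theorem integral_one_add_cos_mul_exp_le {s : ℝ} (hs : 0 < s) :
    ∫ θ in (-π)..π, (1 + cos θ) * exp (-(2 * s * (1 - cos θ))) ≤ 2 * √(π / s) := by
  have hpi := pi_pos
  have hcos : ∀ θ : ℝ, cos θ = 2 * cos (θ / 2) ^ 2 - 1 := fun θ => by
    rw [← cos_two_mul]; ring_nf
  have hder : ∀ θ ∈ Set.uIcc (-π) π, HasDerivAt (fun θ : ℝ => sin (θ / 2)) (cos (θ / 2) / 2) θ :=
    fun θ _ => by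
      simpa [div_eq_mul_inv] using ((hasDerivAt_id θ).div_const 2).sin
  have hsub := intervalIntegral.integral_comp_mul_deriv (g := fun u => exp (-(4 * s) * u ^ 2)) hder
    (by fun_prop) (by fun_prop)
  have hint : MeasureTheory.Integrable fun u : ℝ => exp (-(4 * s) * u ^ 2) :=
    integrable_exp_neg_mul_sq (by positivity)
  calc ∫ θ in (-π)..π, (1 + cos θ) * exp (-(2 * s * (1 - cos θ)))
      ≤ ∫ θ in (-π)..π, 4 *
        (((fun u => exp (-(4 * s) * u ^ 2)) ∘ fun θ => sin (θ / 2)) θ * (cos (θ / 2) / 2)) := by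
        refine intervalIntegral.integral_mono_on (by linarith)
          (Continuous.intervalIntegrable (by fun_prop) _ _)
          (Continuous.intervalIntegrable (by fun_prop) _ _) fun θ hθ => ?_
        have h0 : 0 ≤ cos (θ / 2) :=
          cos_nonneg_of_mem_Icc ⟨by linarith [hθ.1], by linarith [hθ.2]⟩
        have h1 : cos (θ / 2) ^ 2 ≤ cos (θ / 2) := by nlinarith [cos_le_one (θ / 2)]
        have h2 : -(2 * s * (1 - cos θ)) = -(4 * s) * sin (θ / 2) ^ 2 := by
          rw [hcos, sin_sq]; ring
        rw [h2, Function.comp_apply, hcos θ]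
        nlinarith [mul_le_mul_of_nonneg_right h1 (exp_pos (-(4 * s) * sin (θ / 2) ^ 2)).le]
    _ = 4 * ∫ u in (-1)..1, exp (-(4 * s) * u ^ 2) := by
        rw [intervalIntegral.integral_const_mul, hsub, neg_div, sin_neg, sin_pi_div_two]
    _ ≤ 4 * ∫ u : ℝ, exp (-(4 * s) * u ^ 2) := by
        rw [intervalIntegral.integral_of_le (by norm_num)]
        exact mul_le_mul_of_nonneg_left (MeasureTheory.setIntegral_le_integral hint
          (Filter.Eventually.of_forall fun u => (exp_pos _).le)) (by norm_num)
    _ = 2 * √(π / s) := by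
        rw [integral_gaussian, show π / (4 * s) = π / s / 2 ^ 2 by ring,
          sqrt_div' _ (by positivity), sqrt_sq (by norm_num)]
        ring

theorem signMean_self_one_le {α : ℕ → ℝ} {n : ℕ} (hα : ∀ k, 1 ≤ k → α k ∈ Set.Icc (0 : ℝ) 1)
    (hσ : 0 < ∑ i ∈ Finset.Icc 1 n, α i * (1 - α i)) :
    signMean α n n 1 ≤ 1 / √(π * ∑ i ∈ Finset.Icc 1 n, α i * (1 - α i)) := by
  set s := ∑ i ∈ Finset.Icc 1 n, α i * (1 - α i) with hs
  have hpi := pi_pos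
  have hle : 2 * π * signMean α n n 1 ≤ 2 * √(π / s) := by
    rw [signMean_self_one]
    refine le_trans (intervalIntegral.integral_mono_on (by linarith)
      (Continuous.intervalIntegrable (by fun_prop) _ _)
      (Continuous.intervalIntegrable (by fun_prop) _ _) fun θ _ => ?_)
      (integral_one_add_cos_mul_exp_le hσ)
    refine mul_le_mul_of_nonneg_left ?_ (by linarith [neg_one_le_cos θ])
    rw [show -(2 * s * (1 - cos θ)) =
        ∑ i ∈ Finset.Icc 1 n, -(2 * (α i * (1 - α i)) * (1 - cos θ)) by
      rw [Finset.sum_neg_distrib, ← Finset.sum_mul, ← Finset.mul_sum], exp_sum]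
    refine Finset.prod_le_prod (fun i hi => ?_) fun i _ => ?_
    · have h := hα i (Finset.mem_Icc.mp hi).1
      -- With 1 - cos θ ≤ 2 this makes every factor nonnegative, as comparing the products requires.
      have h1 : α i * (1 - α i) ≤ 1 / 4 := by nlinarith [sq_nonneg (α i - 1 / 2)]
      have h2 : 0 ≤ 1 - cos θ := sub_nonneg.mpr (cos_le_one θ)
      nlinarith [neg_one_le_cos θ, mul_le_mul_of_nonneg_right h1 h2]
    · linarith [add_one_le_exp (-(2 * (α i * (1 - α i)) * (1 - cos θ)))]
  have hsq : √(π / s) = π / √(π * s) := by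
    rw [show π / s = π ^ 2 / (π * s) by field_simp, sqrt_div (by positivity), sqrt_sq hpi.le]
  rw [hsq] at hle
  refine le_of_mul_le_mul_left (a := 2 * π) (hle.trans_eq ?_) (by positivity)
  ring

/-! ### Sharpness -/

theorem signMean_half (n : ℕ) :
    signMean (fun _ => 1 / 2) n n 1 =
      2 * ∏ i ∈ Finset.range (n + 1), (2 * (i : ℝ) + 1) / (2 * i + 2) := by
  have h := signMean_self_one (fun _ => 1 / 2) n
  have hf : ∀ θ : ℝ, (1 + cos θ) *
      ∏ i ∈ Finset.Icc 1 n, (1 - 2 * ((1 / 2 : ℝ) * (1 - 1 / 2)) * (1 - cos θ)) =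
      2 * sin (θ / 2 + π / 2) ^ (2 * (n + 1)) := fun θ => by
    have hc : cos θ = 2 * cos (θ / 2) ^ 2 - 1 := by rw [← cos_two_mul]; ring_nf
    -- Each factor is cos²(θ/2); writing the cosine as a shifted sine moves the integral to [0, π].
    rw [Finset.prod_const, Nat.card_Icc, Nat.add_sub_cancel, sin_add_pi_div_two, hc, pow_mul]
    ring
  simp_rw [hf] at h
  rw [intervalIntegral.integral_const_mul,
    intervalIntegral.integral_comp_div_add (fun x => sin x ^ (2 * (n + 1))) two_ne_zero,
    show -π / 2 + π / 2 = 0 by ring, add_halves, integral_sin_pow_even, smul_eq_mul] at h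
  refine mul_left_cancel₀ (mul_ne_zero two_ne_zero pi_ne_zero) (h.trans ?_)
  ring

theorem wallis_eq (k : ℕ) :
    Real.Wallis.W k * ((∏ i ∈ Finset.range k, (2 * (i : ℝ) + 1) / (2 * i + 2)) ^ 2 * (2 * k + 1)) =
      1 := by
  induction k with
  | zero => simp [Real.Wallis.W]
  | succ k ih =>
    refine Eq.trans ?_ ih
    rw [Real.Wallis.W_succ, Finset.prod_range_succ]
    push_cast
    field_simp
    ring

/-- With P the Wallis product, the squared quantity is nP² = (n/(2n + 3)) · W_{n+1}⁻¹, which tends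
to (1/2)(2/π) = 1/π. -/
theorem tendsto_sqrt_mul_signMean_half :
    Filter.Tendsto (fun n : ℕ => √(n / 4) * signMean (fun _ => 1 / 2) n n 1) Filter.atTop
      (nhds (1 / √π)) := by
  have hW := (Real.Wallis.tendsto_W_nhds_pi_div_two.comp (Filter.tendsto_add_atTop_nat 1)).inv₀
    (by positivity)
  have hn : Filter.Tendsto (fun n : ℕ => (n : ℝ) / (2 * n + 3)) Filter.atTop (nhds (1 / 2)) := by
    have := tendsto_natCast_div_add_atTop (3 / 2 : ℝ)
    refine (this.mul_const (1 / 2)).congr' ?_ |>.trans (by simp)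
    filter_upwards with n
    field_simp
  have hlim := (hn.mul hW).sqrt
  have he : 1 / √π = √(1 / 2 * (π / 2)⁻¹) := by
    rw [show (1 : ℝ) / 2 * (π / 2)⁻¹ = 1 / π by field_simp, sqrt_div zero_le_one, sqrt_one]
  rw [he]
  refine hlim.congr fun n => ?_
  rw [signMean_half, Function.comp_apply]
  have hw := wallis_eq (n + 1)
  set P := ∏ i ∈ Finset.range (n + 1), (2 * (i : ℝ) + 1) / (2 * i + 2) with hP
  have hP0 : 0 ≤ P := Finset.prod_nonneg fun i _ => by positivity
  rw [inv_eq_of_mul_eq_one_right hw]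
  push_cast
  rw [show (n : ℝ) / (2 * n + 3) * (P ^ 2 * (2 * (n + 1) + 1)) = n / 4 * (2 * P) ^ 2 by
    field_simp; ring, sqrt_mul (by positivity), sqrt_sq (by positivity)]

/-! ### The theorem -/

theorem mainTheorem1 :
    (∀ (X : Type*) [NormedAddCommGroup X] [NormedSpace ℝ X] (C : Set X) (T : X → X)
        (α : ℕ → ℝ) (x₀ : X),
      Convex ℝ C → Bornology.IsBounded C → Set.MapsTo T C C →
      (∀ x ∈ C, ∀ y ∈ C, ‖T x - T y‖ ≤ ‖x - y‖) →
      (∀ k, 1 ≤ k → α k ∈ Set.Icc (0 : ℝ) 1) → x₀ ∈ C →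
      -- the rate of asymptotic regularity
      (∀ n : ℕ, 0 < ∑ i ∈ Finset.Icc 1 n, α i * (1 - α i) →
        ‖kmIterate T α x₀ n - T (kmIterate T α x₀ n)‖ ≤
          Metric.diam C / √(Real.pi * ∑ i ∈ Finset.Icc 1 n, α i * (1 - α i))) ∧
      -- the recursive bounds, and the bound on the residual which they give
      (∀ m n : ℕ, m ≤ n →
        ‖kmIterate T α x₀ m - kmIterate T α x₀ n‖ ≤ Metric.diam C * kmBound α m n) ∧
      (∀ n : ℕ, 0 < α (n + 1) →
        ‖kmIterate T α x₀ n - T (kmIterate T α x₀ n)‖ ≤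
          Metric.diam C * (kmBound α n (n + 1) / α (n + 1)))) ∧
    -- the best constant that the recursive bounds can give
    IsLeast {κ : ℝ | ∀ (α : ℕ → ℝ) (n : ℕ),
        (∀ k, 1 ≤ k → α k ∈ Set.Icc (0 : ℝ) 1) → 0 < α (n + 1) →
        √(∑ i ∈ Finset.Icc 1 n, α i * (1 - α i)) * (kmBound α n (n + 1) / α (n + 1)) ≤ κ}
      (1 / √Real.pi) := by
  have bound : ∀ {α : ℕ → ℝ} {n : ℕ}, (∀ k, 1 ≤ k → α k ∈ Set.Icc (0 : ℝ) 1) →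
      √(∑ i ∈ Finset.Icc 1 n, α i * (1 - α i)) * signMean α n n 1 ≤ 1 / √π := by
    intro α n hα
    obtain hs | hs := le_or_gt (∑ i ∈ Finset.Icc 1 n, α i * (1 - α i)) 0
    · rw [sqrt_eq_zero_of_nonpos hs, zero_mul]
      positivity
    · refine (mul_le_mul_of_nonneg_left (signMean_self_one_le hα hs) (sqrt_nonneg _)).trans_eq ?_
      have := sqrt_pos.mpr hs
      rw [sqrt_mul pi_pos.le]
      field_simp
  refine ⟨fun X _ _ C T α x₀ hC hb hT hne hα hx₀ => ⟨fun n hs => ?_, fun m n hmn => ?_,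
    fun n hn => ?_⟩, fun α n hα hn => ?_, fun κ hκ => ?_⟩
  · refine ((norm_kmIterate_sub_le hC hb hT hne hα hx₀ n).2 n le_rfl).trans ?_
    rw [div_eq_mul_one_div]
    exact mul_le_mul_of_nonneg_left (signMean_self_one_le hα hs) Metric.diam_nonneg
  · rw [kmBound_eq_signMean α hmn]
    exact (norm_kmIterate_sub_le hC hb hT hne hα hx₀ m).1 n hmn
  · rw [kmBound_succ_div α hn]
    exact (norm_kmIterate_sub_le hC hb hT hne hα hx₀ n).2 n le_rfl
  · rw [kmBound_succ_div α hn]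
    exact bound hα
  · refine le_of_tendsto' tendsto_sqrt_mul_signMean_half fun n => ?_
    have h := hκ (fun _ => 1 / 2) n (fun _ _ => by norm_num) (by norm_num)
    rw [kmBound_succ_div (fun _ => 1 / 2) (by norm_num)] at h
    refine le_trans (le_of_eq ?_) h
    congr 2
    rw [Finset.sum_const, Nat.card_Icc, Nat.add_sub_cancel, nsmul_eq_mul]
    ring
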